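/- **Model.** The typical base station (BS) is at the origin of the plane; the other BSs and the eavesdroppers form independent homogeneous Poisson point processes with densities $\lambda_b\ge 0$ and $\lambda_e>0$. A receiver receives a BS only within distance $r>0$. The path loss over distance $x$ is $b\max(d_0,x)^{-\alpha}$, $b>0$, $d_0\ge 0$, with $\alpha=\alpha_L>0$ on line-of-sight (LOS) links and $\alpha=\alpha_N>0$ on reflected links; reflected signals are also multiplied by the reflection coefficient $\rho\in[0,1]$. Each BS transmits with power $P_t>0$; $\mathbb E[G_e]>0$ is the mean gain, at an eavesdropper, of the ideal sector antenna (gain $G_m$ in the main lobe of beamwidth $\vartheta$, $G_s$ outside) whose misalignment is a centred normal law truncated to $[0,\vartheta/2]$. The obstacles have density $\lambda_0$, mean length $\mathbb E[l]$, mean width $\mathbb E[w]$ and height distribution function $F_H$. The geometry $g=(d,D,\tau,\theta)$ of the typical BS–eavesdropper link (distances $d>0$ and $D>0$, propagation delay $\tau$ with $c\tau\ge D$, angle $\theta$) may be random. Put $$P_{Los}=e^{-k(\beta_0 d+p)},\quad \beta_0=\tfrac{2\lambda_0(\mathbb E[l]+\mathbb E[w])}{\pi},\quad p=\lambda_0\mathbb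 E[l]\mathbb E[w],\quad k=1-\int_0^1F_H(sH_u+(1-s)H_b)\,ds,$$ $$P_{Ref}=\exp\Bigl(-\lambda_0\bigl(\mathbb E[l]\sqrt{c^2\tau^2-D^2\cos^2\theta}+\mathbb E[w]D|\cos\theta|+\mathbb E[l]\mathbb E[w]-\tfrac{\mathbb E[l](c\tau-D)}4-\tfrac{\mathbb E[l]^2\sqrt{c^2\tau^2-D^2}}{8D}\bigr)\Bigr),$$ where $H_b,H_u$ are the heights of BS and user. Given $g$, every BS–eavesdropper pair has an unblocked LOS path with probability $P_{Los}$ and, independently of that, an unblocked reflection path with probability $P_{Ref}$. A link is LOS if it has only the first, reflected if it has only the second, and otherwise contributes nothing. The paths and $g$ are independent of the two point processes. With time switching ratio $\eta\in(0,1)$, the eavesdroppers within distance $r$ of the typical BS collude by maximal-ratio combining, so that $$\mathrm{SINR}=\frac{S_{Los}+S_{Ref}}{I_{Los}+I_{Ref}+I_{x,e}+\sigma_e^2}.$$ Here $S_{Los},S_{Ref}$ are the sums over these eavesdroppers of $(1-\eta)$ times the power received from the typical BS over LOS and over reflected links, $I_{Los},I_{Ref}$ are the same sums with $\eta$ in place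 of $1-\eta$, and $I_{x,e}$ is the sum over these eavesdroppers and all other BSs within distance $r$ of them of the power received over LOS and reflected links. The eavesdropping success probability (ESP) is $P(\mathrm{SINR}>\beta)$. The approximate ESP is the same probability with the noise $\sigma_e^2$ neglected and each of the five sums replaced by its mean over the point processes and the links, given $g$. **Theorem.** Let $$B=P_{Los}(1-P_{Ref})\frac{2}{r^{\alpha_L}(2-\alpha_L)}+\rho(1-P_{Los})P_{Ref}\frac{2}{r^{\alpha_N}(2-\alpha_N)} .$$ Assume $\alpha_L,\alpha_N\ne2$, $B\neq0$ almost surely, and $d_0>0$ or $\alpha_L,\alpha_N<2$. Then the five sums have finite means, the mean total interference given $g$ is almost surely positive, and for every threshold $\beta$ the approximate ESP of the colluding eavesdroppers equals $$P\left(\frac{(1-\eta)\,B}{(\pi r^2\lambda_b+\eta)\,B}>\beta\right).$$ If $d_0=0$ (path loss $b\,x^{-\alpha}$), then moreover, almost surely, the mean total signal power and the mean total interference power given $g$ are $\pi r^2\lambda_eP_t\mathbb E[G_e]\,b\,(1-\eta)B$ and $\pi r^2\lambda_eP_t\mathbb E[G_e]\,b\,(\pi r^2\lambda_b+\eta)B$.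 -/

import Mathlib

open MeasureTheory ProbabilityTheory Set
open scoped NNReal ENNReal

noncomputable section

namespace MmWave

/-- The plane in which base stations and eavesdroppers are located. -/
abbrev Plane : Type := EuclideanSpace ℝ (Fin 2)

/-- The counting measure of a set of points of the plane. -/
def pointMeasure (S : Set Plane) : Measure Plane := Measure.count.restrict S

/-- `Φ` is a homogeneous Poisson point process in the plane with density `lam`: a random locally
finite set whose numbers of points in bounded Borel sets are Poisson with mean `lam * area`, and
independent for disjoint sets. -/
structure IsHPPP {Ω : Type*} [MeasurableSpace Ω] (μ : Measure Ω) (Φ : Ω → Set Plane)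
    (lam : ℝ≥0) : Prop where
  locallyFinite : ∀ ω, ∀ R : ℝ, (Φ ω ∩ Metric.closedBall 0 R).Finite
  measurable : Measurable fun ω => pointMeasure (Φ ω)
  law : ∀ A : Set Plane, MeasurableSet A → Bornology.IsBounded A →
    μ.map (fun ω => (Φ ω ∩ A).ncard) = poissonMeasure (lam * (volume A).toNNReal)
  indep : ∀ (n : ℕ) (A : Fin n → Set Plane), (∀ i, MeasurableSet (A i)) →
    (∀ i, Bornology.IsBounded (A i)) → Pairwise (fun i j => Disjoint (A i) (A j)) →
    iIndepFun (fun i ω => (Φ ω ∩ A i).ncard) μ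

/-- The deterministic parameters of the network. -/
structure Params where
  /-- time switching ratio -/
  η : ℝ
  η_pos : 0 < η
  η_lt_one : η < 1
  /-- transmission power of a base station -/
  Pt : ℝ
  Pt_pos : 0 < Pt
  /-- main lobe gain -/
  Gm : ℝ
  Gm_pos : 0 < Gm
  /-- side lobe gain -/
  Gs : ℝ
  Gs_nonneg : 0 ≤ Gs
  /-- beamwidth of the main lobe -/
  beamwidth : ℝ
  beamwidth_pos : 0 < beamwidth
  /-- variance parameter of the beam misalignment -/
  misVar : ℝ≥0
  misVar_pos : 0 < misVar
  /-- constant factor of the path loss, usually `(c / (4 π f_c)) ^ 2` -/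
  b : ℝ
  b_pos : 0 < b
  /-- reference distance of the path loss; `0` stands for the pure power law -/
  dref : ℝ
  dref_nonneg : 0 ≤ dref
  /-- path loss exponent of line-of-sight links -/
  αL : ℝ
  αL_pos : 0 < αL
  /-- path loss exponent of reflected links -/
  αN : ℝ
  αN_pos : 0 < αN
  /-- reflection coefficient -/
  ρ : ℝ
  ρ_nonneg : 0 ≤ ρ
  ρ_le_one : ρ ≤ 1
  /-- density of the base stations -/
  lamB : ℝ≥0
  /-- density of the eavesdroppers -/
  lamE : ℝ≥0
  lamE_pos : 0 < lamE
  /-- largest distance from which signals are received -/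
  r : ℝ
  r_pos : 0 < r
  /-- noise power -/
  noise : ℝ
  noise_nonneg : 0 ≤ noise
  /-- speed of propagation -/
  c : ℝ
  c_pos : 0 < c
  /-- density of the obstacles and reflectors -/
  lam0 : ℝ≥0
  /-- law of the length of an object -/
  lenLaw : Measure ℝ
  lenLaw_prob : IsProbabilityMeasure lenLaw
  lenLaw_nonneg : ∀ᵐ l ∂lenLaw, 0 ≤ l
  lenLaw_integrable : Integrable (fun l : ℝ => l) lenLaw
  /-- law of the width of an object -/
  widLaw : Measure ℝ
  widLaw_prob : IsProbabilityMeasure widLaw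
  widLaw_nonneg : ∀ᵐ w ∂widLaw, 0 ≤ w
  widLaw_integrable : Integrable (fun w : ℝ => w) widLaw
  /-- law of the height of an object -/
  heightLaw : Measure ℝ
  heightLaw_prob : IsProbabilityMeasure heightLaw
  /-- height of a base station -/
  Hb : ℝ
  /-- height of a user -/
  Hu : ℝ

namespace Params

variable (p : Params)

/-- mean length of an object -/
def meanLen : ℝ := ∫ l, l ∂p.lenLaw

/-- mean width of an object -/
def meanWid : ℝ := ∫ w, w ∂p.widLaw

/-- `β₀`, the mean number of objects met per unit of distance -/
def β₀ : ℝ := 2 * p.lam0 * (p.meanLen + p.meanWid) / Real.pi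

/-- the constant `p` in the mean number `β₀ d + p` of objects met by a link of length `d` -/
def objConst : ℝ := p.lam0 * p.meanLen * p.meanWid

/-- the height scaling factor `k = 1 - ∫₀¹ F_H (s H_u + (1 - s) H_b) ds`, with `F_H` the
distribution function of the height of an object -/
def heightFactor : ℝ := 1 - ∫ s in (0 : ℝ)..1, cdf p.heightLaw (s * p.Hu + (1 - s) * p.Hb)

/-- `P_Los`: the probability that a line-of-sight path of length `d` is not blocked -/
def pLos (d : ℝ) : ℝ := Real.exp (-(p.heightFactor * (p.β₀ * d + p.objConst)))

/-- `P_Ref`: the probability that there is an unblocked first-order reflection path with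
propagation delay `τ`, for a link of length `D` and angle `θ` -/
def pRef (D τ θ : ℝ) : ℝ :=
  Real.exp (-(p.lam0 * (p.meanLen * √(p.c ^ 2 * τ ^ 2 - D ^ 2 * Real.cos θ ^ 2)
    + p.meanWid * D * |Real.cos θ| + p.meanLen * p.meanWid
    - p.meanLen * (p.c * τ - D) / 4
    - p.meanLen ^ 2 * √(p.c ^ 2 * τ ^ 2 - D ^ 2) / (8 * D))))

/-- The ideal sector antenna. -/
def sectorGain (ω : ℝ) : ℝ := if ω ≤ p.beamwidth / 2 then p.Gm else p.Gs

/-- The law of the beam misalignment: a centred normal law truncated to `[0, beamwidth / 2]`. -/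
def misalignmentLaw : Measure ℝ := (gaussianReal 0 p.misVar)[|Icc 0 (p.beamwidth / 2)]

/-- `E[G_e]`: the mean antenna gain obtained by an eavesdropper -/
def meanGain : ℝ := ∫ ω, p.sectorGain ω ∂p.misalignmentLaw

/-- path loss over distance `x` of a link with path loss exponent `α` -/
def pathLoss (α x : ℝ) : ℝ := p.b * (max p.dref x) ^ (-α)

/-- The common bracket of the numerator and the denominator of the approximate SINR, for link
probabilities `PL` and `PR`. -/
def bracket (PL PR : ℝ) : ℝ :=
  PL * (1 - PR) * (2 / (p.r ^ p.αL * (2 - p.αL)))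
    + p.ρ * (1 - PL) * PR * (2 / (p.r ^ p.αN * (2 - p.αN)))

/-- the numerator of the approximate SINR -/
def numer (PL PR : ℝ) : ℝ := (1 - p.η) * p.bracket PL PR

/-- the denominator of the approximate SINR -/
def denom (PL PR : ℝ) : ℝ := (Real.pi * p.r ^ 2 * p.lamB + p.η) * p.bracket PL PR

end Params

/-- The random network. The typical base station is at the origin; `bs` is the set of the other
base stations, `eve` the set of the eavesdroppers. All remaining randomness (the obstacles, hence
the links, and the geometry of the typical link) is in the random element `env`. The link
probabilities are those of the typical link, the same for all links. -/
structure Network (p : Params) {Ω : Type*} (E : Type*) [MeasurableSpace Ω] [MeasurableSpace E]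
    (μ : Measure Ω) where
  bs : Ω → Set Plane
  eve : Ω → Set Plane
  env : Ω → E
  bs_hppp : IsHPPP μ bs p.lamB
  eve_hppp : IsHPPP μ eve p.lamE
  env_measurable : Measurable env
  indep_bs_eve : IndepFun (fun ω => pointMeasure (bs ω)) (fun ω => pointMeasure (eve ω)) μ
  indep_env : IndepFun env (fun ω => (pointMeasure (bs ω), pointMeasure (eve ω))) μ
  /-- distance between the typical base station and an eavesdropper, in `P_Los` -/
  d : E → ℝ
  /-- distance between base station and eavesdropper, in `P_Ref` -/
  D : E → ℝ
  /-- propagation delay of the reflection path -/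
  τ : E → ℝ
  /-- angle of the link, in `P_Ref` -/
  θ : E → ℝ
  d_measurable : Measurable d
  D_measurable : Measurable D
  τ_measurable : Measurable τ
  θ_measurable : Measurable θ
  d_pos : ∀ᵐ ω ∂μ, 0 < d (env ω)
  D_pos : ∀ᵐ ω ∂μ, 0 < D (env ω)
  D_le : ∀ᵐ ω ∂μ, D (env ω) ≤ p.c * τ (env ω)
  /-- `(e, x, y) ∈ los`: in the environment `e` there is an unblocked line-of-sight path from the
  base station at `x` to the eavesdropper at `y` -/
  los : Set (E × Plane × Plane)
  /-- `(e, x, y) ∈ ref`: in the environment `e` there is an unblocked first-order reflection path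
  from the base station at `x` to the eavesdropper at `y` -/
  ref : Set (E × Plane × Plane)
  los_measurable : MeasurableSet los
  ref_measurable : MeasurableSet ref
  los_prob : ∀ x y : Plane, x ≠ y →
    μ[{ω | (env ω, x, y) ∈ los}.indicator (fun _ => (1 : ℝ)) |
        MeasurableSpace.comap (fun ω => (d (env ω), D (env ω), τ (env ω), θ (env ω))) inferInstance]
      =ᵐ[μ] fun ω => p.pLos (d (env ω))
  ref_prob : ∀ x y : Plane, x ≠ y →
    μ[{ω | (env ω, x, y) ∈ ref}.indicator (fun _ => (1 : ℝ)) |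
        MeasurableSpace.comap (fun ω => (d (env ω), D (env ω), τ (env ω), θ (env ω))) inferInstance]
      =ᵐ[μ] fun ω => p.pRef (D (env ω)) (τ (env ω)) (θ (env ω))
  /-- Given the geometry, the two kinds of paths of a link exist independently. -/
  los_ref_prob : ∀ x y : Plane, x ≠ y →
    μ[{ω | (env ω, x, y) ∈ los ∩ ref}.indicator (fun _ => (1 : ℝ)) |
        MeasurableSpace.comap (fun ω => (d (env ω), D (env ω), τ (env ω), θ (env ω))) inferInstance]
      =ᵐ[μ] fun ω => p.pLos (d (env ω)) * p.pRef (D (env ω)) (τ (env ω)) (θ (env ω))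

/-- The five aggregate powers at the central unit of the colluding eavesdroppers: information
signal of the typical base station over line-of-sight and over reflected links, its
power-transfer signal over both, and the interference of the other base stations. -/
structure Powers where
  sLos : ℝ
  sRef : ℝ
  iLos : ℝ
  iRef : ℝ
  iCross : ℝ

/-- total signal power -/
def Powers.signal (P : Powers) : ℝ := P.sLos + P.sRef

/-- total interference power -/
def Powers.interference (P : Powers) : ℝ := P.iLos + P.iRef + P.iCross

/-- SINR after maximal-ratio combining, for a given noise power -/
def Powers.sinr (P : Powers) (noise : ℝ) : ℝ := P.signal / (P.interference + noise)

namespace Network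

variable {p : Params} {Ω E : Type*} [MeasurableSpace Ω] [MeasurableSpace E] {μ : Measure Ω}
  (N : Network p E μ)

open scoped Classical in
/-- power received at `y` from the base station at `x` over a line-of-sight link (a link with a
line-of-sight path and no reflection path) of length at most `r` -/
def losPower (ω : Ω) (x y : Plane) : ℝ :=
  if dist x y ≤ p.r ∧ (N.env ω, x, y) ∈ N.los \ N.ref then
    p.Pt * p.meanGain * p.pathLoss p.αL (dist x y) else 0

open scoped Classical in
/-- power received at `y` from the base station at `x` over a reflected link (a link with a
reflection path and no line-of-sight path) of length at most `r` -/
def refPower (ω : Ω) (x y : Plane) : ℝ :=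
  if dist x y ≤ p.r ∧ (N.env ω, x, y) ∈ N.ref \ N.los then
    p.Pt * p.meanGain * p.pathLoss p.αN (dist x y) * p.ρ else 0

open scoped Classical in
/-- The random aggregate powers, summed over all eavesdroppers in range of the typical base
station, and for `iCross` over all other base stations in range of the eavesdropper. -/
def powers (ω : Ω) : Powers where
  sLos := ∑' y : N.eve ω, (1 - p.η) * N.losPower ω 0 y
  sRef := ∑' y : N.eve ω, (1 - p.η) * N.refPower ω 0 y
  iLos := ∑' y : N.eve ω, p.η * N.losPower ω 0 y
  iRef := ∑' y : N.eve ω, p.η * N.refPower ω 0 y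
  iCross := ∑' y : N.eve ω, ∑' x : N.bs ω,
    if dist (0 : Plane) y ≤ p.r then N.losPower ω x y + N.refPower ω x y else 0

/-- SINR of the colluding eavesdroppers -/
def sinr (ω : Ω) : ℝ := (N.powers ω).sinr p.noise

/-- eavesdropping success probability of the colluding eavesdroppers at threshold `β` -/
def esp (β : ℝ) : ℝ≥0∞ := μ {ω | β < N.sinr ω}

/-- the information on the geometry of the typical link -/
abbrev geometry : MeasurableSpace Ω :=
  MeasurableSpace.comap
    (fun ω => (N.d (N.env ω), N.D (N.env ω), N.τ (N.env ω), N.θ (N.env ω))) inferInstance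

/-- the aggregate powers, each replaced by its mean given the geometry of the typical link -/
def meanPowers (ω : Ω) : Powers where
  sLos := (μ[fun ω' => (N.powers ω').sLos | N.geometry]) ω
  sRef := (μ[fun ω' => (N.powers ω').sRef | N.geometry]) ω
  iLos := (μ[fun ω' => (N.powers ω').iLos | N.geometry]) ω
  iRef := (μ[fun ω' => (N.powers ω').iRef | N.geometry]) ω
  iCross := (μ[fun ω' => (N.powers ω').iCross | N.geometry]) ω

/-- the SINR with the aggregate powers replaced by their means and the noise neglected -/
def approxSinr (ω : Ω) : ℝ := (N.meanPowers ω).sinr 0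

/-- the approximate eavesdropping success probability of the colluding eavesdroppers -/
def approxEsp (β : ℝ) : ℝ≥0∞ := μ {ω | β < N.approxSinr ω}

/-- `P_Los` of the (random) typical link -/
def PLos (ω : Ω) : ℝ := p.pLos (N.d (N.env ω))

/-- `P_Ref` of the (random) typical link -/
def PRef (ω : Ω) : ℝ := p.pRef (N.D (N.env ω)) (N.τ (N.env ω)) (N.θ (N.env ω))

end Network

end MmWave

end

/-!
Campbell's formula for the Poisson processes, applied conditionally on the geometry, shows that
thinning the points by links of a given kind multiplies the mean of a sum over the points by the
conditional probability of such a link, because that probability is the same for all pairs.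
The mean signal and the mean interference are therefore multiples, with the factors `1 - η` and
`π r² λ_b + η`, of the same conditional mean power. This power cancels in the approximate SINR, as
does the bracket `B` in the claimed ratio, whether or not the two are proportional. They are so for
the pure power law, where polar coordinates give
`∫_{‖x‖ ≤ r} ‖x‖ ^ (-α) dx = 2 π r ^ (2 - α) / (2 - α)`.
-/

noncomputable section

namespace MmWave

lemma lintegral_natCast_poissonMeasure (r : ℝ≥0) :
    ∫⁻ n, (n : ℝ≥0∞) ∂poissonMeasure r = r := by
  have hshift (n : ℕ) : ((n + 1 : ℕ) : ℝ≥0∞) * poissonMeasure r {n + 1} =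
      r * poissonMeasure r {n} := by
    simp only [poissonMeasure_singleton]
    rw [← ENNReal.ofReal_natCast, ← ENNReal.ofReal_coe_nnreal,
      ← ENNReal.ofReal_mul (by positivity), ← ENNReal.ofReal_mul (by positivity),
      Nat.factorial_succ]
    congr 1
    push_cast
    field_simp
    ring
  have hmass : ∑' n, poissonMeasure r {n} = 1 := by
    simpa using (lintegral_countable' (μ := poissonMeasure r) fun _ => 1).symm
  rw [lintegral_countable', tsum_eq_zero_add' ENNReal.summable]
  simp_rw [hshift, ENNReal.tsum_mul_left, hmass]
  simp only [Nat.cast_zero, zero_mul, mul_one, zero_add]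

section Kernel

variable {α β : Type*} [MeasurableSpace α] [MeasurableSpace β] {κ : Kernel α β}

lemma isSFiniteKernel_of_forall_ne_top (h : ∀ a, κ a univ ≠ ∞) : IsSFiniteKernel κ := by
  classical
  let level (a : α) : ℕ := ⌊(κ a univ).toNNReal⌋₊
  have hlevel : Measurable level :=
    Nat.measurable_floor.comp (κ.measurable_coe .univ).ennreal_toNNReal
  let piece (n : ℕ) : Kernel α β := Kernel.piecewise (hlevel (measurableSet_singleton n)) κ 0
  have hpiece (n : ℕ) (a : α) : piece n a = if level a = n then κ a else 0 := by
    simp only [piece, Kernel.piecewise_apply, mem_preimage, mem_singleton_iff]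
    rfl
  have (n : ℕ) : IsFiniteKernel (piece n) := by
    refine ⟨⟨n + 1, by finiteness, fun a => ?_⟩⟩
    rw [hpiece]
    split_ifs with hn
    · rw [← ENNReal.coe_toNNReal (h a), ← hn]
      exact_mod_cast (Nat.lt_floor_add_one _).le
    · simp only [Measure.coe_zero, Pi.zero_apply, zero_le]
  have hsum : Kernel.sum piece = κ := by
    ext a s hs
    rw [Kernel.sum_apply' _ _ hs, tsum_eq_single (level a)]
    · simp only [hpiece, if_true]
    · intro n hn
      simp only [hpiece, hn.symm, if_false, Measure.coe_zero, Pi.zero_apply]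
  exact hsum ▸ Kernel.isSFiniteKernel_sum

lemma isSFiniteKernel_of_spanning {s : ℕ → Set β} (hs : ∀ n, MeasurableSet (s n))
    (hspan : ⋃ n, s n = univ) (h : ∀ n a, κ a (s n) ≠ ∞) : IsSFiniteKernel κ := by
  have hd := MeasurableSet.disjointed hs
  have (n : ℕ) : IsSFiniteKernel (κ.restrict (hd n)) :=
    isSFiniteKernel_of_forall_ne_top fun a => by
      rw [Kernel.restrict_apply, Measure.restrict_apply_univ]
      exact measure_ne_top_of_subset (disjointed_subset s n) (h n a)
  have hsum : Kernel.sum (fun n => κ.restrict (hd n)) = κ := by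
    ext a : 1
    simp only [Kernel.sum_apply, Kernel.restrict_apply]
    rw [← Measure.restrict_iUnion (disjoint_disjointed s) hd, iUnion_disjointed, hspan,
      Measure.restrict_univ]
  exact hsum ▸ Kernel.isSFiniteKernel_sum

end Kernel

section BoundedSets

variable {Y : Type*} [PseudoMetricSpace Y] [MeasurableSpace Y]

/-- The bounded measurable sets, on which the laws of point processes are prescribed. -/
def boundedMeasurableSets (Y : Type*) [PseudoMetricSpace Y] [MeasurableSpace Y] : Set (Set Y) :=
  {s | MeasurableSet s ∧ Bornology.IsBounded s}

lemma isPiSystem_boundedMeasurableSets : IsPiSystem (boundedMeasurableSets Y) :=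
  fun _ hs _ ht _ => ⟨hs.1.inter ht.1, hs.2.subset inter_subset_left⟩

variable [OpensMeasurableSpace Y]

lemma closedBall_mem_boundedMeasurableSets (y : Y) (R : ℝ) :
    Metric.closedBall y R ∈ boundedMeasurableSets Y :=
  ⟨measurableSet_closedBall, Metric.isBounded_closedBall⟩

lemma generateFrom_boundedMeasurableSets [Nonempty Y] :
    MeasurableSpace.generateFrom (boundedMeasurableSets Y) = ‹MeasurableSpace Y› := by
  refine le_antisymm (MeasurableSpace.generateFrom_le fun s hs => hs.1) fun s hs => ?_
  obtain ⟨y⟩ := ‹Nonempty Y›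
  rw [← inter_univ s, ← Metric.iUnion_closedBall_nat y, inter_iUnion]
  exact MeasurableSet.iUnion fun n => MeasurableSpace.measurableSet_generateFrom
    ⟨hs.inter measurableSet_closedBall, Metric.isBounded_closedBall.subset inter_subset_right⟩

/-- The balls of integer radius around `y`, as a spanning sequence of bounded measurable sets. -/
def finiteSpanningClosedBalls [ProperSpace Y] (ν : Measure Y) [IsFiniteMeasureOnCompacts ν]
    (y : Y) : ν.FiniteSpanningSetsIn (boundedMeasurableSets Y) where
  set n := Metric.closedBall y n
  set_mem n := closedBall_mem_boundedMeasurableSets y n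
  finite _ := measure_closedBall_lt_top
  spanning := Metric.iUnion_closedBall_nat y

end BoundedSets

section ConditionalProbability

variable {Ω : Type*} {m m₀ : MeasurableSpace Ω} {μ : Measure Ω}

lemma condProb_nonneg (T : Set Ω) : 0 ≤ᵐ[μ] μ⟦T|m⟧ :=
  condExp_nonneg (.of_forall fun ω => indicator_nonneg (fun _ _ => zero_le_one) ω)

variable [IsFiniteMeasure μ]

lemma condProb_diff {S T : Set Ω} (hS : MeasurableSet S) (hT : MeasurableSet T) :
    μ⟦S \ T|m⟧ =ᵐ[μ] μ⟦S|m⟧ - μ⟦S ∩ T|m⟧ := by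
  have hind : (S \ T).indicator (fun _ => (1 : ℝ)) =
      S.indicator (fun _ => 1) - (S ∩ T).indicator (fun _ => 1) := by
    rw [← sdiff_inter_self_eq_sdiff, inter_comm T S, indicator_sdiff inter_subset_left]
  rw [hind]
  exact condExp_sub ((integrable_const 1).indicator hS)
    ((integrable_const 1).indicator (hS.inter hT)) m

lemma setLIntegral_ofReal_condProb (hm : m ≤ m₀) {T : Set Ω} (hT : MeasurableSet T)
    {A : Set Ω} (hA : MeasurableSet[m] A) :
    ∫⁻ ω in A, ENNReal.ofReal ((μ⟦T|m⟧) ω) ∂μ = μ (A ∩ T) := by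
  rw [← ofReal_integral_eq_lintegral_ofReal integrable_condExp.integrableOn
      (ae_restrict_of_ae (condProb_nonneg T)),
    setIntegral_condExp hm ((integrable_const 1).indicator hT) hA,
    setIntegral_indicator hT, setIntegral_const, smul_eq_mul, mul_one, ofReal_measureReal]

lemma integrable_toReal_and_condExp_toReal_of_setLIntegral_eq (hm : m ≤ m₀) {X : Ω → ℝ≥0∞}
    (hX : Measurable X) {q : Ω → ℝ} (hqm : Measurable[m] q) (hq0 : 0 ≤ᵐ[μ] q)
    (hqi : Integrable q μ)
    (h : ∀ A, MeasurableSet[m] A → ∫⁻ ω in A, X ω ∂μ = ∫⁻ ω in A, ENNReal.ofReal (q ω) ∂μ) :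
    Integrable (fun ω => (X ω).toReal) μ ∧ μ[fun ω => (X ω).toReal|m] =ᵐ[μ] q := by
  have htop : ∫⁻ ω, X ω ∂μ ≠ ∞ := by
    rw [← setLIntegral_univ, h _ MeasurableSet.univ, setLIntegral_univ]
    exact hqi.lintegral_lt_top.ne
  have hint := integrable_toReal_of_lintegral_ne_top hX.aemeasurable htop
  refine ⟨hint, (ae_eq_condExp_of_forall_setIntegral_eq hm hint (fun _ _ _ => hqi.integrableOn)
    (fun A hA _ => ?_) hqm.stronglyMeasurable.aestronglyMeasurable).symm⟩
  rw [integral_toReal hX.aemeasurable (ae_restrict_of_ae (ae_lt_top hX htop)), h A hA,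
    integral_eq_lintegral_of_nonneg_ae (ae_restrict_of_ae hq0)
      hqi.aestronglyMeasurable.restrict]

end ConditionalProbability

section Campbell

variable {Ω X Y : Type*} {m : MeasurableSpace Ω} [MeasurableSpace Ω] [MeasurableSpace X]
  [MeasurableSpace Y] {μ : Measure Ω} {κ : Kernel Ω Y} {ξ : Ω → X} {ν : Measure Y}

/-- `ν` is the intensity of the random measure `κ` also under the knowledge of the mark `ξ`: the
Campbell measure of the pairs `(ξ ω, y)`, with `y` distributed according to `κ ω`, is a product. -/
def HasIndepIntensity (μ : Measure Ω) (κ : Kernel Ω Y) (ξ : Ω → X) (ν : Measure Y) : Prop :=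
  (μ ⊗ₘ κ).map (Prod.map ξ id) = (μ.map ξ).prod ν

lemma hasIndepIntensity_of_generateFrom [IsFiniteMeasure μ] [IsSFiniteKernel κ]
    (hξ : Measurable ξ) {C : Set (Set Y)}
    (hC : MeasurableSpace.generateFrom C = ‹MeasurableSpace Y›) (hpi : IsPiSystem C)
    (hspan : ν.FiniteSpanningSetsIn C) (hind : ∀ s ∈ C, IndepFun ξ (fun ω => κ ω s) μ)
    (hmean : ∀ s ∈ C, ∫⁻ ω, κ ω s ∂μ = ν s) : HasIndepIntensity μ κ ξ ν := by
  refine (Measure.prod_eq_generateFrom MeasurableSpace.generateFrom_measurableSet hC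
    MeasurableSpace.isPiSystem_measurableSet hpi (μ.map ξ).toFiniteSpanningSetsIn hspan
    fun B hB s hs => ?_).symm
  have hsm : MeasurableSet s := hC ▸ MeasurableSpace.measurableSet_generateFrom hs
  have hB1 : Measurable (B.indicator (1 : X → ℝ≥0∞)) := measurable_one.indicator hB
  have hfactor : ∫⁻ ω in ξ ⁻¹' B, κ ω s ∂μ = μ (ξ ⁻¹' B) * ν s := calc
    _ = ∫⁻ ω, B.indicator 1 (ξ ω) * κ ω s ∂μ := by
        rw [← lintegral_indicator (hξ hB)]
        refine lintegral_congr fun ω => ?_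
        by_cases hω : ξ ω ∈ B <;> simp [hω]
    _ = (∫⁻ ω, B.indicator 1 (ξ ω) ∂μ) * ∫⁻ ω, κ ω s ∂μ :=
        lintegral_mul_eq_lintegral_mul_lintegral_of_indepFun (hB1.comp hξ)
          (κ.measurable_coe hsm) ((hind s hs).comp hB1 measurable_id)
    _ = μ (ξ ⁻¹' B) * ν s := by
        rw [hmean s hs, ← lintegral_indicator_one (hξ hB)]
        rfl
  rw [Measure.map_apply (hξ.prodMap measurable_id) (hB.prod hsm), preimage_prod_map_prod,
    preimage_id, Measure.compProd_apply_prod (hξ hB) hsm, Measure.map_apply hξ hB, hfactor]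

namespace HasIndepIntensity

variable [SFinite μ] [IsSFiniteKernel κ] [SFinite ν]

lemma lintegral_lintegral (h : HasIndepIntensity μ κ ξ ν) (hξ : Measurable ξ)
    {f : X × Y → ℝ≥0∞} (hf : Measurable f) :
    ∫⁻ ω, ∫⁻ y, f (ξ ω, y) ∂κ ω ∂μ = ∫⁻ y, ∫⁻ ω, f (ξ ω, y) ∂μ ∂ν := by
  have hmap : Measurable (Prod.map ξ (id : Y → Y)) := hξ.prodMap measurable_id
  calc ∫⁻ ω, ∫⁻ y, f (ξ ω, y) ∂κ ω ∂μ
    _ = ∫⁻ z, f (Prod.map ξ id z) ∂(μ ⊗ₘ κ) :=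
        (Measure.lintegral_compProd (hf.comp hmap)).symm
    _ = ∫⁻ z, f z ∂(μ.map ξ).prod ν := by rw [← lintegral_map hf hmap, h]
    _ = ∫⁻ y, ∫⁻ x, f (x, y) ∂μ.map ξ ∂ν := lintegral_prod_symm' f hf
    _ = ∫⁻ y, ∫⁻ ω, f (ξ ω, y) ∂μ ∂ν :=
        lintegral_congr fun y => lintegral_map (hf.comp measurable_prodMk_right) hξ

end HasIndepIntensity

/-- The integral of `h` against `κ ω`, thinned by keeping only the `y` with `(ξ ω, y) ∈ S`. -/
def thinnedIntegral (κ : Kernel Ω Y) (ξ : Ω → X) (S : Set (X × Y)) (h : Y → ℝ≥0∞) (ω : Ω) :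
    ℝ≥0∞ :=
  ∫⁻ y, S.indicator (fun z => h z.2) (ξ ω, y) ∂κ ω

variable {S : Set (X × Y)} {h : Y → ℝ≥0∞}

lemma measurable_thinnedIntegral [IsSFiniteKernel κ] (hξ : Measurable ξ) (hS : MeasurableSet S)
    (hh : Measurable h) : Measurable (thinnedIntegral κ ξ S h) :=
  Measurable.lintegral_kernel_prod_right (f := fun ω y => S.indicator (fun z => h z.2) (ξ ω, y))
    (((hh.comp measurable_snd).indicator hS).comp (hξ.prodMap measurable_id))

namespace HasIndepIntensity

variable [IsSFiniteKernel κ] [SFinite ν]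

lemma setLIntegral_thinnedIntegral [SFinite μ] (hκ : HasIndepIntensity μ κ ξ ν)
    (hξ : Measurable ξ) (hS : MeasurableSet S) (hh : Measurable h) {B : Set X}
    (hB : MeasurableSet B) :
    ∫⁻ ω in ξ ⁻¹' B, thinnedIntegral κ ξ S h ω ∂μ =
      ∫⁻ y, h y * μ (ξ ⁻¹' B ∩ {ω | (ξ ω, y) ∈ S}) ∂ν := by
  let f : X × Y → ℝ≥0∞ := (Prod.fst ⁻¹' B).indicator (S.indicator fun z => h z.2)
  have hf : Measurable f :=
    ((hh.comp measurable_snd).indicator hS).indicator (measurable_fst hB)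
  calc ∫⁻ ω in ξ ⁻¹' B, thinnedIntegral κ ξ S h ω ∂μ
    _ = ∫⁻ ω, ∫⁻ y, f (ξ ω, y) ∂κ ω ∂μ := by
        rw [← lintegral_indicator (hξ hB)]
        refine lintegral_congr fun ω => ?_
        by_cases hω : ξ ω ∈ B <;> simp [f, thinnedIntegral, hω]
    _ = ∫⁻ y, ∫⁻ ω, f (ξ ω, y) ∂μ ∂ν := hκ.lintegral_lintegral hξ hf
    _ = ∫⁻ y, h y * μ (ξ ⁻¹' B ∩ {ω | (ξ ω, y) ∈ S}) ∂ν := by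
        refine lintegral_congr fun y => ?_
        have hSy : MeasurableSet {ω | (ξ ω, y) ∈ S} := (hξ.prodMk measurable_const) hS
        rw [← lintegral_indicator_const ((hξ hB).inter hSy)]
        refine lintegral_congr fun ω => ?_
        by_cases hω : ξ ω ∈ B <;> by_cases hS : (ξ ω, y) ∈ S <;> simp [f, hω, hS]

lemma integrable_and_condExp_toReal_thinnedIntegral [IsFiniteMeasure μ]
    (hκ : HasIndepIntensity μ κ ξ ν) (hξ : Measurable ξ) (hS : MeasurableSet S) (hh : Measurable h)
    (hfin : ∫⁻ y, h y ∂ν ≠ ∞) (hm : m ≤ MeasurableSpace.comap ξ inferInstance)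
    {q : Ω → ℝ} (hqm : Measurable[m] q) (hq0 : 0 ≤ᵐ[μ] q) (hqi : Integrable q μ)
    (hq : ∀ᵐ y ∂ν, μ⟦{ω | (ξ ω, y) ∈ S} | m⟧ =ᵐ[μ] q) :
    Integrable (fun ω => (thinnedIntegral κ ξ S h ω).toReal) μ ∧
      μ[fun ω => (thinnedIntegral κ ξ S h ω).toReal|m] =ᵐ[μ]
        fun ω => (∫⁻ y, h y ∂ν).toReal * q ω := by
  have hm₀ := hm.trans hξ.comap_le
  refine integrable_toReal_and_condExp_toReal_of_setLIntegral_eq hm₀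
    (measurable_thinnedIntegral hξ hS hh) (hqm.const_mul _)
    (hq0.mono fun ω => mul_nonneg ENNReal.toReal_nonneg) (hqi.const_mul _) fun A hA => ?_
  obtain ⟨B, hB, rfl⟩ := hm A hA
  have hkept : ∀ᵐ y ∂ν, μ (ξ ⁻¹' B ∩ {ω | (ξ ω, y) ∈ S}) =
      ∫⁻ ω in ξ ⁻¹' B, ENNReal.ofReal (q ω) ∂μ := by
    filter_upwards [hq] with y hy
    have hSy : MeasurableSet {ω | (ξ ω, y) ∈ S} := (hξ.prodMk measurable_const) hS
    rw [← setLIntegral_ofReal_condProb hm₀ hSy hA]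
    exact lintegral_congr_ae (ae_restrict_of_ae (hy.fun_comp ENNReal.ofReal))
  calc ∫⁻ ω in ξ ⁻¹' B, thinnedIntegral κ ξ S h ω ∂μ
    _ = ∫⁻ y, h y * ∫⁻ ω in ξ ⁻¹' B, ENNReal.ofReal (q ω) ∂μ ∂ν := by
        rw [hκ.setLIntegral_thinnedIntegral hξ hS hh hB]
        exact lintegral_congr_ae (hkept.mono fun y hy => congrArg (h y * ·) hy)
    _ = ∫⁻ ω in ξ ⁻¹' B, (∫⁻ y, h y ∂ν) * ENNReal.ofReal (q ω) ∂μ := by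
        rw [lintegral_mul_const _ hh,
          lintegral_const_mul _ (hqm.mono hm₀ le_rfl).ennreal_ofReal]
    _ = ∫⁻ ω in ξ ⁻¹' B, ENNReal.ofReal ((∫⁻ y, h y ∂ν).toReal * q ω) ∂μ := by
        simp_rw [ENNReal.ofReal_mul ENNReal.toReal_nonneg, ENNReal.ofReal_toReal hfin]

end HasIndepIntensity

end Campbell

namespace IsHPPP

variable {Ω : Type*} [MeasurableSpace Ω] {μ : Measure Ω} {Φ Ψ : Ω → Set Plane} {lam lam' : ℝ≥0}

lemma inter_finite (h : IsHPPP μ Φ lam) (ω : Ω) {A : Set Plane} (hA : Bornology.IsBounded A) :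
    (Φ ω ∩ A).Finite := by
  obtain ⟨R, hR⟩ := hA.subset_closedBall 0
  exact (h.locallyFinite ω R).subset (inter_subset_inter_right _ hR)

lemma countable (h : IsHPPP μ Φ lam) (ω : Ω) : (Φ ω).Countable := by
  rw [← inter_univ (Φ ω), ← Metric.iUnion_closedBall_nat 0, inter_iUnion]
  exact countable_iUnion fun n => (h.locallyFinite ω n).countable

lemma pointMeasure_apply (h : IsHPPP μ Φ lam) (ω : Ω) {A : Set Plane}
    (hA : A ∈ boundedMeasurableSets Plane) :
    pointMeasure (Φ ω) A = ((Φ ω ∩ A).ncard : ℝ≥0∞) := by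
  rw [pointMeasure, Measure.restrict_apply hA.1, inter_comm,
    Measure.count_apply_finite _ (h.inter_finite ω hA.2),
    ncard_eq_toFinset_card _ (h.inter_finite ω hA.2)]

lemma lintegral_pointMeasure (h : IsHPPP μ Φ lam) (ω : Ω) (f : Plane → ℝ≥0∞) :
    ∫⁻ y, f y ∂pointMeasure (Φ ω) = ∑' y : Φ ω, f y := by
  simp only [pointMeasure, lintegral_countable _ (h.countable ω), Measure.count_singleton, mul_one]

lemma lintegral_pointMeasure_ne_top (h : IsHPPP μ Φ lam) (ω : Ω) {f : Plane → ℝ≥0∞}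
    (hf : ∀ y, f y ≠ ∞) (hb : Bornology.IsBounded (Function.support f)) :
    ∫⁻ y, f y ∂pointMeasure (Φ ω) ≠ ∞ := by
  rw [h.lintegral_pointMeasure, tsum_subtype,
    tsum_eq_sum (s := (h.inter_finite ω hb).toFinset) fun y hy => ?_]
  · exact ENNReal.sum_ne_top.2 fun y _ => ne_top_of_le_ne_top (hf y) (indicator_le_self _ f y)
  · simp_all

lemma lintegral_pointMeasure_apply (h : IsHPPP μ Φ lam) {A : Set Plane}
    (hA : A ∈ boundedMeasurableSets Plane) :
    ∫⁻ ω, pointMeasure (Φ ω) A ∂μ = lam * volume A := by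
  have hlaw := h.law A hA.1 hA.2
  have hm : AEMeasurable (fun ω => (Φ ω ∩ A).ncard) μ :=
    .of_map_ne_zero (hlaw ▸ IsProbabilityMeasure.ne_zero _)
  simp_rw [h.pointMeasure_apply _ hA]
  rw [← lintegral_map' (f := fun n : ℕ => (n : ℝ≥0∞)) (by fun_prop) hm, hlaw,
    lintegral_natCast_poissonMeasure, ENNReal.coe_mul,
    ENNReal.coe_toNNReal hA.2.measure_lt_top.ne]

/-- The counting measure of a Poisson point process, as a kernel. -/
def kernel (h : IsHPPP μ Φ lam) : Kernel Ω Plane := ⟨fun ω => pointMeasure (Φ ω), h.measurable⟩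

lemma kernel_apply (h : IsHPPP μ Φ lam) (ω : Ω) : h.kernel ω = pointMeasure (Φ ω) := rfl

instance (h : IsHPPP μ Φ lam) : IsSFiniteKernel h.kernel :=
  isSFiniteKernel_of_spanning (fun _ => measurableSet_closedBall) (Metric.iUnion_closedBall_nat 0)
    fun n ω => by
      rw [h.kernel_apply, h.pointMeasure_apply ω (closedBall_mem_boundedMeasurableSets 0 n)]
      finiteness

variable [IsFiniteMeasure μ] {X : Type*} [MeasurableSpace X] {ξ : Ω → X}

lemma hasIndepIntensity (h : IsHPPP μ Φ lam) (hξ : Measurable ξ)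
    (hind : IndepFun ξ (fun ω => pointMeasure (Φ ω)) μ) :
    HasIndepIntensity μ h.kernel ξ (lam • volume) :=
  hasIndepIntensity_of_generateFrom hξ generateFrom_boundedMeasurableSets
    isPiSystem_boundedMeasurableSets (finiteSpanningClosedBalls _ 0)
    (fun _ hs => hind.comp measurable_id (Measure.measurable_coe hs.1))
    fun _ hs => h.lintegral_pointMeasure_apply hs

lemma hasIndepIntensity_prod (hΦ : IsHPPP μ Φ lam) (hΨ : IsHPPP μ Ψ lam') (hξ : Measurable ξ)
    (hindep : IndepFun (fun ω => pointMeasure (Φ ω)) (fun ω => pointMeasure (Ψ ω)) μ)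
    (hind : IndepFun ξ (fun ω => (pointMeasure (Φ ω), pointMeasure (Ψ ω))) μ) :
    HasIndepIntensity μ (hΦ.kernel ×ₖ hΨ.kernel) ξ
      ((lam • volume : Measure Plane).prod (lam' • volume)) := by
  let spanning (lam : ℝ≥0) := finiteSpanningClosedBalls (lam • volume : Measure Plane) 0
  refine hasIndepIntensity_of_generateFrom hξ
    (generateFrom_eq_prod generateFrom_boundedMeasurableSets generateFrom_boundedMeasurableSets
      (spanning lam).isCountablySpanning (spanning lam').isCountablySpanning)
    (isPiSystem_boundedMeasurableSets.prod isPiSystem_boundedMeasurableSets)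
    ((spanning lam).prod (spanning lam')) ?_ ?_
  · rintro _ ⟨s, hs, t, ht, rfl⟩
    simp only [Kernel.prod_apply_prod, kernel_apply]
    exact hind.comp (ψ := fun ν : Measure Plane × Measure Plane => ν.1 s * ν.2 t) measurable_id
      (((Measure.measurable_coe hs.1).comp measurable_fst).mul
        ((Measure.measurable_coe ht.1).comp measurable_snd))
  · rintro _ ⟨s, hs, t, ht, rfl⟩
    have hst : IndepFun (fun ω => pointMeasure (Φ ω) s) (fun ω => pointMeasure (Ψ ω) t) μ :=
      hindep.comp (Measure.measurable_coe hs.1) (Measure.measurable_coe ht.1)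
    calc ∫⁻ ω, (hΦ.kernel ×ₖ hΨ.kernel) ω (s ×ˢ t) ∂μ
      _ = ∫⁻ ω, pointMeasure (Φ ω) s * pointMeasure (Ψ ω) t ∂μ := by
          simp only [Kernel.prod_apply_prod, kernel_apply]
      _ = (∫⁻ ω, pointMeasure (Φ ω) s ∂μ) * ∫⁻ ω, pointMeasure (Ψ ω) t ∂μ :=
          lintegral_mul_eq_lintegral_mul_lintegral_of_indepFun
            ((Measure.measurable_coe hs.1).comp hΦ.measurable)
            ((Measure.measurable_coe ht.1).comp hΨ.measurable) hst
      _ = _ := by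
          rw [hΦ.lintegral_pointMeasure_apply hs, hΨ.lintegral_pointMeasure_apply ht,
            Measure.prod_prod]
          rfl

end IsHPPP

section RadialIntegral

variable {F : Type*} [NormedAddCommGroup F]

lemma indicator_closedBall_zero_comp_norm {β : Type*} [Zero β] (f : ℝ → β) (r : ℝ) :
    (Metric.closedBall (0 : F) r).indicator (fun x => f ‖x‖) =
      fun x => (Iic r).indicator f ‖x‖ := by
  ext x
  simp only [indicator, mem_closedBall_zero_iff, mem_Iic]

variable [NormedSpace ℝ F] [FiniteDimensional ℝ F] [Nontrivial F]
  [MeasurableSpace F] [BorelSpace F] (ν : Measure F) [ν.IsAddHaarMeasure]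

lemma setIntegral_closedBall_zero_comp_norm (f : ℝ → ℝ) (r : ℝ) :
    ∫ x in Metric.closedBall 0 r, f ‖x‖ ∂ν =
      Module.finrank ℝ F * ν.real (Metric.ball 0 1) *
        ∫ y in Ioc 0 r, y ^ (Module.finrank ℝ F - 1) * f y := by
  rw [← integral_indicator measurableSet_closedBall, indicator_closedBall_zero_comp_norm,
    integral_fun_norm_addHaar ν ((Iic r).indicator f), ← Ioi_inter_Iic,
    ← setIntegral_indicator measurableSet_Iic]
  simp only [indicator_mul_right, smul_eq_mul, nsmul_eq_mul, mul_assoc]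

lemma integrableOn_closedBall_zero_comp_norm {f : ℝ → ℝ} {r : ℝ}
    (hf : IntegrableOn (fun y => y ^ (Module.finrank ℝ F - 1) * f y) (Ioc 0 r)) :
    IntegrableOn (fun x => f ‖x‖) (Metric.closedBall 0 r) ν := by
  rw [← integrable_indicator_iff measurableSet_closedBall, indicator_closedBall_zero_comp_norm,
    integrable_fun_norm_addHaar ν]
  simp only [smul_eq_mul, ← indicator_mul_right (Iic r) (fun y => y ^ (Module.finrank ℝ F - 1)) f]
  rwa [IntegrableOn, integrable_indicator_iff measurableSet_Iic, IntegrableOn,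
    Measure.restrict_restrict measurableSet_Iic, inter_comm, Ioi_inter_Iic]

end RadialIntegral

/-- The two kinds of links that carry power, for a uniform treatment of both. -/
inductive LinkKind
  | los
  | ref

namespace Params

variable (p : Params)

lemma meanGain_eq : p.meanGain = p.Gm := by
  have hpos : gaussianReal 0 p.misVar (Icc 0 (p.beamwidth / 2)) ≠ 0 := by
    intro h0
    have hvol := gaussianReal_absolutelyContinuous' 0 p.misVar_pos.ne' h0
    rw [Real.volume_Icc, ENNReal.ofReal_eq_zero] at hvol
    linarith [p.beamwidth_pos]
  have : IsProbabilityMeasure p.misalignmentLaw := cond_isProbabilityMeasure hpos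
  have hmain : p.sectorGain =ᵐ[p.misalignmentLaw] fun _ => p.Gm :=
    (ae_cond_mem measurableSet_Icc).mono fun ω hω => if_pos hω.2
  rw [meanGain, integral_congr_ae hmain, integral_const, probReal_univ, one_smul]

lemma meanGain_pos : 0 < p.meanGain := p.meanGain_eq ▸ p.Gm_pos

lemma measurable_pathLoss (α : ℝ) : Measurable (p.pathLoss α) := by
  unfold pathLoss
  fun_prop

lemma pathLoss_nonneg (α x : ℝ) : 0 ≤ p.pathLoss α x :=
  mul_nonneg p.b_pos.le (Real.rpow_nonneg (le_max_of_le_left p.dref_nonneg) _)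

lemma pathLoss_pos (α : ℝ) {x : ℝ} (hx : 0 < x) : 0 < p.pathLoss α x :=
  mul_pos p.b_pos (Real.rpow_pos_of_pos (lt_max_of_lt_right hx) _)

lemma mul_pathLoss_of_dref_eq_zero (h0 : p.dref = 0) (α : ℝ) {y : ℝ} (hy : 0 < y) :
    y * p.pathLoss α y = p.b * y ^ (1 - α) := by
  rw [pathLoss, h0, max_eq_right hy.le, sub_eq_add_neg, Real.rpow_add hy, Real.rpow_one]
  ring

lemma integrableOn_pathLoss {α : ℝ} (hα : 0 ≤ α) (h : 0 < p.dref ∨ α < 2) :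
    IntegrableOn (fun x : Plane => p.pathLoss α ‖x‖) (Metric.closedBall 0 p.r) := by
  rcases p.dref_nonneg.lt_or_eq with hd | hd
  · refine Measure.integrableOn_of_bounded (M := p.b * p.dref ^ (-α))
      measure_closedBall_lt_top.ne
      ((p.measurable_pathLoss α).comp measurable_norm).aestronglyMeasurable (.of_forall fun x => ?_)
    rw [Real.norm_of_nonneg (p.pathLoss_nonneg _ _)]
    exact mul_le_mul_of_nonneg_left
      (Real.rpow_le_rpow_of_nonpos hd (le_max_left _ _) (neg_nonpos.2 hα)) p.b_pos.le
  · have hα2 : α < 2 := h.resolve_left hd.not_lt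
    refine integrableOn_closedBall_zero_comp_norm volume ?_
    simp only [finrank_euclideanSpace_fin, Nat.add_one_sub_one, pow_one]
    rw [integrableOn_congr_fun (fun y hy => p.mul_pathLoss_of_dref_eq_zero hd.symm α hy.1)
      measurableSet_Ioc, ← intervalIntegrable_iff_integrableOn_Ioc_of_le p.r_pos.le]
    exact (intervalIntegral.intervalIntegrable_rpow' (by linarith)).const_mul p.b

/-- The integral of the path loss over the disc of radius `r`. -/
def discLoss (α : ℝ) : ℝ := ∫ x in Metric.closedBall (0 : Plane) p.r, p.pathLoss α ‖x‖

lemma discLoss_pos {α : ℝ} (hα : 0 ≤ α) (h : 0 < p.dref ∨ α < 2) : 0 < p.discLoss α := by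
  rw [discLoss, setIntegral_pos_iff_support_of_nonneg_ae
    (.of_forall fun x => p.pathLoss_nonneg _ _) (p.integrableOn_pathLoss hα h)]
  have hsub : Metric.ball (0 : Plane) p.r \ {0} ⊆
      Function.support (fun x : Plane => p.pathLoss α ‖x‖) ∩ Metric.closedBall 0 p.r :=
    fun x hx => ⟨(p.pathLoss_pos α (norm_pos_iff.2 hx.2)).ne', Metric.ball_subset_closedBall hx.1⟩
  refine lt_of_lt_of_le ?_ (measure_mono hsub)
  rw [measure_sdiff_null (measure_singleton _)]
  exact Metric.measure_ball_pos _ _ p.r_pos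

lemma discLoss_of_dref_eq_zero {α : ℝ} (h0 : p.dref = 0) (hα : α < 2) :
    p.discLoss α = Real.pi * p.r ^ 2 * p.b * (2 / (p.r ^ α * (2 - α))) := by
  have hrpow : ∫ y in Ioc 0 p.r, y * p.pathLoss α y = p.b * (p.r ^ (2 - α) / (2 - α)) := by
    rw [setIntegral_congr_fun measurableSet_Ioc
      (fun y hy => p.mul_pathLoss_of_dref_eq_zero h0 α hy.1),
      ← intervalIntegral.integral_of_le p.r_pos.le, intervalIntegral.integral_const_mul,
      integral_rpow (Or.inl (by linarith)), show 1 - α + 1 = 2 - α by ring,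
      Real.zero_rpow (by linarith), sub_zero]
  have hball : (volume : Measure Plane).real (Metric.ball 0 1) = Real.pi := by
    simp [Measure.real, Real.pi_nonneg]
  rw [discLoss, setIntegral_closedBall_zero_comp_norm, hball, finrank_euclideanSpace_fin]
  simp only [Nat.add_one_sub_one, pow_one]
  rw [hrpow, Real.rpow_sub p.r_pos, Real.rpow_two]
  push_cast
  field_simp

/-- The path loss exponent of a link. -/
def exponent : LinkKind → ℝ
  | .los => p.αL
  | .ref => p.αN

/-- The factor by which power is multiplied along a link in addition to the path loss. -/
def attenuation : LinkKind → ℝ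
  | .los => 1
  | .ref => p.ρ

lemma exponent_nonneg : ∀ k, 0 ≤ p.exponent k
  | .los => p.αL_pos.le
  | .ref => p.αN_pos.le

lemma attenuation_nonneg : ∀ k, 0 ≤ p.attenuation k
  | .los => zero_le_one
  | .ref => p.ρ_nonneg

/-- The power received over a link of kind `k` and length `s`, which is `0` beyond the range `r`.
It takes values in `ℝ≥0∞` because it is summed over point processes before finiteness is known. -/
def linkPower (k : LinkKind) : ℝ → ℝ≥0∞ :=
  (Iic p.r).indicator fun s =>
    ENNReal.ofReal (p.Pt * p.meanGain * p.attenuation k * p.pathLoss (p.exponent k) s)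

lemma measurable_linkPower (k : LinkKind) : Measurable (p.linkPower k) :=
  ((p.measurable_pathLoss _).const_mul _).ennreal_ofReal.indicator measurableSet_Iic

lemma linkPower_ne_top (k : LinkKind) (s : ℝ) : p.linkPower k s ≠ ∞ :=
  ne_top_of_le_ne_top ENNReal.ofReal_ne_top (indicator_le_self _ _ s)

lemma linkPower_of_lt (k : LinkKind) {s : ℝ} (hs : p.r < s) : p.linkPower k s = 0 :=
  indicator_of_notMem (notMem_Iic.2 hs) _

lemma toReal_linkPower (k : LinkKind) {s : ℝ} (hs : s ≤ p.r) : (p.linkPower k s).toReal =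
    p.Pt * p.meanGain * p.attenuation k * p.pathLoss (p.exponent k) s := by
  rw [linkPower, indicator_of_mem (mem_Iic.2 hs), ENNReal.toReal_ofReal]
  have := p.Pt_pos
  have := p.meanGain_pos
  have := p.attenuation_nonneg k
  have := p.pathLoss_nonneg (p.exponent k) s
  positivity

/-- The integral over the plane of the power received over links of kind `k`. -/
def planePower (k : LinkKind) : ℝ :=
  p.Pt * p.meanGain * p.attenuation k * p.discLoss (p.exponent k)

lemma planePower_nonneg (k : LinkKind) : 0 ≤ p.planePower k :=
  mul_nonneg (mul_nonneg (mul_pos p.Pt_pos p.meanGain_pos).le (p.attenuation_nonneg k))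
    (setIntegral_nonneg measurableSet_closedBall fun _ _ => p.pathLoss_nonneg _ _)

variable {p} {k : LinkKind}

lemma planePower_pos (h : 0 < p.dref ∨ p.exponent k < 2) (hk : 0 < p.attenuation k) :
    0 < p.planePower k :=
  mul_pos (mul_pos (mul_pos p.Pt_pos p.meanGain_pos) hk) (p.discLoss_pos (p.exponent_nonneg k) h)

lemma lintegral_linkPower_norm (h : 0 < p.dref ∨ p.exponent k < 2) :
    ∫⁻ x : Plane, p.linkPower k ‖x‖ = ENNReal.ofReal (p.planePower k) := by
  have hgain : 0 ≤ p.Pt * p.meanGain * p.attenuation k :=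
    mul_nonneg (mul_pos p.Pt_pos p.meanGain_pos).le (p.attenuation_nonneg k)
  unfold linkPower
  rw [← indicator_closedBall_zero_comp_norm, lintegral_indicator measurableSet_closedBall,
    planePower, discLoss, ← integral_const_mul, ofReal_integral_eq_lintegral_ofReal
      ((p.integrableOn_pathLoss (p.exponent_nonneg k) h).const_mul _)
      (.of_forall fun x => mul_nonneg hgain (p.pathLoss_nonneg _ _))]

lemma lintegral_linkPower_dist (h : 0 < p.dref ∨ p.exponent k < 2) (y : Plane) :
    ∫⁻ x : Plane, p.linkPower k (dist x y) = ENNReal.ofReal (p.planePower k) := by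
  simp_rw [dist_eq_norm]
  rw [lintegral_sub_right_eq_self (fun x => p.linkPower k ‖x‖) y, lintegral_linkPower_norm h]

variable (p)

lemma measurable_pLos : Measurable p.pLos := by
  unfold pLos
  fun_prop

lemma measurable_pRef : Measurable fun z : ℝ × ℝ × ℝ => p.pRef z.1 z.2.1 z.2.2 := by
  unfold pRef
  fun_prop

/-- The power received at `y` from a base station at `x` over a link of kind `k`, counted only if
`y` is in range of the typical base station. -/
def crossPower (k : LinkKind) : Plane × Plane → ℝ≥0∞ :=
  (Prod.snd ⁻¹' Metric.closedBall 0 p.r).indicator fun z => p.linkPower k (dist z.1 z.2)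

lemma measurable_crossPower (k : LinkKind) : Measurable (p.crossPower k) :=
  ((p.measurable_linkPower k).comp measurable_dist).indicator
    (measurable_snd measurableSet_closedBall)

lemma crossPower_ne_top (k : LinkKind) (z : Plane × Plane) : p.crossPower k z ≠ ∞ :=
  ne_top_of_le_ne_top (p.linkPower_ne_top k _) (indicator_le_self _ _ z)

variable {p}

lemma lintegral_crossPower (h : 0 < p.dref ∨ p.exponent k < 2) :
    ∫⁻ z, p.crossPower k z
        ∂(p.lamB • volume : Measure Plane).prod (p.lamE • volume : Measure Plane) =
      ENNReal.ofReal (Real.pi * p.r ^ 2 * p.lamB * (p.lamE * p.planePower k)) := by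
  have hinner (y : Plane) :
      ∫⁻ x, p.crossPower k (x, y) ∂(p.lamB • volume : Measure Plane) =
        (Metric.closedBall 0 p.r).indicator
          (fun _ => p.lamB * ENNReal.ofReal (p.planePower k)) y := by
    by_cases hy : y ∈ Metric.closedBall 0 p.r
    · simp only [crossPower, indicator, mem_preimage, hy, if_true]
      rw [lintegral_smul_measure, lintegral_linkPower_dist h]
      rfl
    · simp only [crossPower, indicator, mem_preimage, hy, if_false, lintegral_zero]
  have hdisc : (volume : Measure Plane) (Metric.closedBall 0 p.r) =
      ENNReal.ofReal (Real.pi * p.r ^ 2) := by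
    rw [EuclideanSpace.volume_closedBall_fin_two, ← ENNReal.ofReal_pow p.r_pos.le, mul_comm,
      ENNReal.ofReal_mul Real.pi_nonneg]
  rw [lintegral_prod_symm' _ (p.measurable_crossPower k)]
  simp_rw [hinner]
  rw [lintegral_indicator_const measurableSet_closedBall, Measure.smul_apply, hdisc,
    ENNReal.smul_def, smul_eq_mul, ← ENNReal.ofReal_coe_nnreal, ← ENNReal.ofReal_coe_nnreal,
    ← ENNReal.ofReal_mul p.lamB.coe_nonneg, ← ENNReal.ofReal_mul p.lamE.coe_nonneg,
    ← ENNReal.ofReal_mul (mul_nonneg p.lamB.coe_nonneg (p.planePower_nonneg k))]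
  congr 1
  ring

end Params

lemma ae_fst_ne_snd {Y : Type*} [MeasurableSpace Y] [MeasurableEq Y] {μ ν : Measure Y}
    [SFinite ν] [NullSingletonClass ν] : ∀ᵐ z ∂μ.prod ν, z.1 ≠ z.2 := by
  refine (Measure.ae_prod_iff_ae_ae measurableSet_diagonal.compl).2 (.of_forall fun x => ?_)
  exact (ν.ae_ne x).mono fun y => Ne.symm

namespace Network

variable {p : Params} {Ω E : Type*} [MeasurableSpace Ω] [MeasurableSpace E] {μ : Measure Ω}
  (N : Network p E μ)

/-- The set of all `(e, x, y)` such that in the environment `e` the base station at `x` and the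
eavesdropper at `y` have a link of kind `k`. -/
def links : LinkKind → Set (E × Plane × Plane)
  | .los => N.los \ N.ref
  | .ref => N.ref \ N.los

/-- The conditional probability, given the geometry, that a link is of kind `k`. -/
def linkProb (k : LinkKind) (ω : Ω) : ℝ :=
  match k with
  | .los => N.PLos ω * (1 - N.PRef ω)
  | .ref => (1 - N.PLos ω) * N.PRef ω

lemma measurableSet_links : ∀ k, MeasurableSet (N.links k)
  | .los => N.los_measurable.diff N.ref_measurable
  | .ref => N.ref_measurable.diff N.los_measurable

lemma geometry_le_comap_env : N.geometry ≤ MeasurableSpace.comap N.env inferInstance := by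
  have hmeas : Measurable fun e => (N.d e, N.D e, N.τ e, N.θ e) :=
    N.d_measurable.prodMk (N.D_measurable.prodMk (N.τ_measurable.prodMk N.θ_measurable))
  exact MeasurableSpace.comap_comp.symm.trans_le (MeasurableSpace.comap_mono hmeas.comap_le)

lemma measurable_linkProb (k : LinkKind) : Measurable[N.geometry] (N.linkProb k) := by
  have hgeom : Measurable[N.geometry] fun ω =>
      (N.d (N.env ω), N.D (N.env ω), N.τ (N.env ω), N.θ (N.env ω)) := comap_measurable _
  have hPLos : Measurable[N.geometry] N.PLos := p.measurable_pLos.comp (measurable_fst.comp hgeom)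
  have hPRef : Measurable[N.geometry] N.PRef :=
    Measurable.comp (f := fun ω => (N.D (N.env ω), N.τ (N.env ω), N.θ (N.env ω)))
      p.measurable_pRef (measurable_snd.comp hgeom)
  cases k
  · exact hPLos.mul (measurable_const.sub hPRef)
  · exact (measurable_const.sub hPLos).mul hPRef

section LinkProbability

variable [IsFiniteMeasure μ]

lemma condProb_links (k : LinkKind) {x y : Plane} (hxy : x ≠ y) :
    μ⟦{ω | (N.env ω, x, y) ∈ N.links k}|N.geometry⟧ =ᵐ[μ] N.linkProb k := by
  have hpair : Measurable fun ω => (N.env ω, x, y) := N.env_measurable.prodMk measurable_const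
  cases k with
  | los =>
    filter_upwards [condProb_diff (m := N.geometry) (μ := μ) (hpair N.los_measurable)
      (hpair N.ref_measurable), N.los_prob x y hxy, N.los_ref_prob x y hxy] with ω hdiff hlos hboth
    refine hdiff.trans ((congrArg₂ (· - ·) hlos hboth).trans ?_)
    simp only [linkProb, PLos, PRef]
    ring
  | ref =>
    have hboth := N.los_ref_prob x y hxy
    rw [inter_comm] at hboth
    filter_upwards [condProb_diff (m := N.geometry) (μ := μ) (hpair N.ref_measurable)
      (hpair N.los_measurable), N.ref_prob x y hxy, hboth] with ω hdiff href hboth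
    refine hdiff.trans ((congrArg₂ (· - ·) href hboth).trans ?_)
    simp only [linkProb, PLos, PRef]
    ring

lemma linkProb_nonneg (k : LinkKind) : 0 ≤ᵐ[μ] N.linkProb k := by
  obtain ⟨x, y, hxy⟩ := exists_pair_ne Plane
  exact (condProb_nonneg _).trans_eq (N.condProb_links k hxy)

lemma integrable_linkProb (k : LinkKind) : Integrable (N.linkProb k) μ := by
  obtain ⟨x, y, hxy⟩ := exists_pair_ne Plane
  exact integrable_condExp.congr (N.condProb_links k hxy)

end LinkProbability

/-- The total power that the eavesdroppers receive from the typical base station over links of kind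
`k`, before time switching. -/
def signalSum (k : LinkKind) : Ω → ℝ≥0∞ :=
  thinnedIntegral N.eve_hppp.kernel N.env {z | (z.1, 0, z.2) ∈ N.links k}
    fun y => p.linkPower k (dist 0 y)

/-- The total power that the eavesdroppers in range of the typical base station receive from the
other base stations over links of kind `k`. -/
def crossSum (k : LinkKind) : Ω → ℝ≥0∞ :=
  thinnedIntegral (N.bs_hppp.kernel ×ₖ N.eve_hppp.kernel) N.env (N.links k) (p.crossPower k)

section ConditionalMean

variable [IsProbabilityMeasure μ] {k : LinkKind}

lemma integrable_and_condExp_toReal_signalSum (h : 0 < p.dref ∨ p.exponent k < 2) :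
    Integrable (fun ω => (N.signalSum k ω).toReal) μ ∧
      μ[fun ω => (N.signalSum k ω).toReal|N.geometry] =ᵐ[μ]
        fun ω => p.lamE * p.planePower k * N.linkProb k ω := by
  have hmean : ∫⁻ y, p.linkPower k (dist 0 y) ∂(p.lamE • volume : Measure Plane) =
      ENNReal.ofReal (p.lamE * p.planePower k) := by
    simp_rw [dist_zero_left]
    rw [lintegral_smul_measure, Params.lintegral_linkPower_norm h,
      ENNReal.ofReal_mul p.lamE.coe_nonneg, ENNReal.ofReal_coe_nnreal]
    rfl
  have hne : ∀ᵐ y ∂(p.lamE • volume : Measure Plane), y ≠ 0 :=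
    Measure.ae_smul_measure (volume.ae_ne 0) _
  have hS : MeasurableSet {z : E × Plane | (z.1, (0 : Plane), z.2) ∈ N.links k} :=
    (measurable_fst.prodMk (measurable_const.prodMk measurable_snd)) (N.measurableSet_links k)
  have hind := N.eve_hppp.hasIndepIntensity N.env_measurable
    (N.indep_env.comp measurable_id measurable_snd)
  have hcamp := hind.integrable_and_condExp_toReal_thinnedIntegral
    (h := fun y => p.linkPower k (dist 0 y)) N.env_measurable hS
    ((p.measurable_linkPower k).comp (measurable_const.dist measurable_id))
    (hmean ▸ ENNReal.ofReal_ne_top) N.geometry_le_comap_env (N.measurable_linkProb k)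
    (N.linkProb_nonneg k) (N.integrable_linkProb k)
    (hne.mono fun y hy => N.condProb_links k hy.symm)
  rwa [hmean, ENNReal.toReal_ofReal
    (mul_nonneg p.lamE.coe_nonneg (p.planePower_nonneg k))] at hcamp

lemma integrable_and_condExp_toReal_crossSum (h : 0 < p.dref ∨ p.exponent k < 2) :
    Integrable (fun ω => (N.crossSum k ω).toReal) μ ∧
      μ[fun ω => (N.crossSum k ω).toReal|N.geometry] =ᵐ[μ]
        fun ω => Real.pi * p.r ^ 2 * p.lamB * (p.lamE * p.planePower k) * N.linkProb k ω := by
  have : (p.lamE • volume : Measure Plane).IsAddHaarMeasure := .nnreal_smul _ p.lamE_pos.ne'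
  have hne : ∀ᵐ z ∂(p.lamB • volume : Measure Plane).prod (p.lamE • volume : Measure Plane),
      z.1 ≠ z.2 := ae_fst_ne_snd
  have hmean := Params.lintegral_crossPower h
  have hind := N.bs_hppp.hasIndepIntensity_prod N.eve_hppp N.env_measurable N.indep_bs_eve
    N.indep_env
  have hcamp := hind.integrable_and_condExp_toReal_thinnedIntegral
    N.env_measurable (N.measurableSet_links k) (p.measurable_crossPower k)
    (hmean ▸ ENNReal.ofReal_ne_top) N.geometry_le_comap_env (N.measurable_linkProb k)
    (N.linkProb_nonneg k) (N.integrable_linkProb k)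
    (hne.mono fun z hz => N.condProb_links k hz)
  have hnonneg : 0 ≤ Real.pi * p.r ^ 2 * p.lamB * (p.lamE * p.planePower k) := by
    have := p.planePower_nonneg k
    positivity
  rwa [hmean, ENNReal.toReal_ofReal hnonneg] at hcamp

end ConditionalMean

end Network

namespace Network

variable {p : Params} {Ω E : Type*} [MeasurableSpace Ω] [MeasurableSpace E] {μ : Measure Ω}
  (N : Network p E μ) (k : LinkKind) (ω : Ω)

/-- The power received at `y` from the base station at `x` if they have a link of kind `k`, and `0`
otherwise. -/
def linkedPower (x y : Plane) : ℝ≥0∞ :=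
  (N.links k).indicator (fun z => p.linkPower k (dist z.2.1 z.2.2)) (N.env ω, x, y)

/-- The restriction of `linkedPower` to eavesdroppers in range of the typical base station. -/
def linkedCrossPower (x y : Plane) : ℝ≥0∞ :=
  (N.links k).indicator (fun z => p.crossPower k z.2) (N.env ω, x, y)

lemma linkedPower_ne_top (x y : Plane) : N.linkedPower k ω x y ≠ ∞ :=
  ne_top_of_le_ne_top (p.linkPower_ne_top k _) (indicator_le_self _ _ (N.env ω, x, y))

lemma linkedCrossPower_ne_top (x y : Plane) : N.linkedCrossPower k ω x y ≠ ∞ :=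
  ne_top_of_le_ne_top (p.crossPower_ne_top k _) (indicator_le_self _ _ (N.env ω, x, y))

lemma linkedCrossPower_of_dist_zero_le {x y : Plane} (hy : dist 0 y ≤ p.r) :
    N.linkedCrossPower k ω x y = N.linkedPower k ω x y := by
  have hmem : y ∈ Metric.closedBall 0 p.r := Metric.mem_closedBall'.2 hy
  simp only [linkedCrossPower, linkedPower, Params.crossPower, indicator, mem_preimage, hmem,
    if_true]

lemma linkedCrossPower_of_lt_dist_zero {x y : Plane} (hy : p.r < dist 0 y) :
    N.linkedCrossPower k ω x y = 0 := by
  have hmem : y ∉ Metric.closedBall 0 p.r := fun h => (Metric.mem_closedBall'.1 h).not_gt hy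
  simp only [linkedCrossPower, Params.crossPower, indicator, mem_preimage, hmem, if_false, ite_self]

lemma linkedCrossPower_of_lt_dist {x y : Plane} (hxy : p.r < dist x y) :
    N.linkedCrossPower k ω x y = 0 := by
  simp only [linkedCrossPower, Params.crossPower, indicator, p.linkPower_of_lt k hxy, ite_self]

open scoped Classical in
lemma toReal_linkedPower (x y : Plane) : (N.linkedPower k ω x y).toReal =
    if dist x y ≤ p.r ∧ (N.env ω, x, y) ∈ N.links k then
      p.Pt * p.meanGain * p.attenuation k * p.pathLoss (p.exponent k) (dist x y) else 0 := by
  by_cases hlink : (N.env ω, x, y) ∈ N.links k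
  · rw [linkedPower, indicator_of_mem hlink]
    split_ifs with h
    · exact p.toReal_linkPower k h.1
    · rw [p.linkPower_of_lt k (not_le.1 fun hr => h ⟨hr, hlink⟩), ENNReal.toReal_zero]
  · rw [linkedPower, indicator_of_notMem hlink, if_neg (mt And.right hlink), ENNReal.toReal_zero]

lemma losPower_eq (x y : Plane) : N.losPower ω x y = (N.linkedPower .los ω x y).toReal := by
  rw [toReal_linkedPower, losPower, Params.attenuation, mul_one]
  congr

lemma refPower_eq (x y : Plane) : N.refPower ω x y = (N.linkedPower .ref ω x y).toReal := by
  rw [toReal_linkedPower, refPower, mul_right_comm]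
  congr

lemma signalSum_eq_tsum : N.signalSum k ω = ∑' y : N.eve ω, N.linkedPower k ω 0 y :=
  N.eve_hppp.lintegral_pointMeasure ω _

lemma crossSum_eq_lintegral : N.crossSum k ω =
    ∫⁻ y, ∫⁻ x, N.linkedCrossPower k ω x y ∂pointMeasure (N.bs ω) ∂pointMeasure (N.eve ω) := by
  have hmeas : Measurable fun z : Plane × Plane => N.linkedCrossPower k ω z.1 z.2 :=
    (((p.measurable_crossPower k).comp measurable_snd).indicator (N.measurableSet_links k)).comp
      (measurable_const.prodMk measurable_id)
  exact Kernel.lintegral_prod_symm N.bs_hppp.kernel N.eve_hppp.kernel ω hmeas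

lemma lintegral_linkedCrossPower_ne_top (y : Plane) :
    ∫⁻ x, N.linkedCrossPower k ω x y ∂pointMeasure (N.bs ω) ≠ ∞ := by
  have hball : Bornology.IsBounded (Metric.closedBall y p.r) := Metric.isBounded_closedBall
  refine N.bs_hppp.lintegral_pointMeasure_ne_top ω (fun x => N.linkedCrossPower_ne_top k ω x y)
    (hball.subset fun x hx => ?_)
  exact not_lt.1 (mt (N.linkedCrossPower_of_lt_dist k ω) hx)

lemma crossSum_ne_top : N.crossSum k ω ≠ ∞ := by
  have hball : Bornology.IsBounded (Metric.closedBall (0 : Plane) p.r) :=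
    Metric.isBounded_closedBall
  rw [crossSum_eq_lintegral]
  refine N.eve_hppp.lintegral_pointMeasure_ne_top ω (N.lintegral_linkedCrossPower_ne_top k ω)
    (hball.subset fun y hy => ?_)
  rw [Metric.mem_closedBall', ← not_lt]
  intro hlt
  exact hy (by simp only [N.linkedCrossPower_of_lt_dist_zero k ω hlt, lintegral_zero])

lemma crossSum_eq_tsum :
    N.crossSum k ω = ∑' y : N.eve ω, ∑' x : N.bs ω, N.linkedCrossPower k ω x y := by
  rw [crossSum_eq_lintegral, N.eve_hppp.lintegral_pointMeasure]
  exact tsum_congr fun y => N.bs_hppp.lintegral_pointMeasure ω _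

lemma tsum_const_mul_toReal_linkedPower (a : ℝ) :
    ∑' y : N.eve ω, a * (N.linkedPower k ω 0 y).toReal = a * (N.signalSum k ω).toReal := by
  rw [tsum_mul_left, signalSum_eq_tsum,
    ENNReal.tsum_toReal_eq fun y : N.eve ω => N.linkedPower_ne_top k ω 0 y]

open scoped Classical in
lemma toReal_linkedCrossPower_add (x y : Plane) :
    (N.linkedCrossPower .los ω x y + N.linkedCrossPower .ref ω x y).toReal =
      if dist (0 : Plane) y ≤ p.r then N.losPower ω x y + N.refPower ω x y else 0 := by
  split_ifs with hy
  · rw [N.linkedCrossPower_of_dist_zero_le .los ω hy, N.linkedCrossPower_of_dist_zero_le .ref ω hy,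
      ENNReal.toReal_add (N.linkedPower_ne_top _ _ _ _) (N.linkedPower_ne_top _ _ _ _),
      losPower_eq, refPower_eq]
  · simp only [N.linkedCrossPower_of_lt_dist_zero _ ω (not_le.1 hy), add_zero, ENNReal.toReal_zero]

lemma iCross_powers :
    (N.powers ω).iCross = (N.crossSum .los ω).toReal + (N.crossSum .ref ω).toReal := by
  have hne (k : LinkKind) (y : N.eve ω) : ∑' x : N.bs ω, N.linkedCrossPower k ω x y ≠ ∞ := by
    rw [← N.bs_hppp.lintegral_pointMeasure ω fun x => N.linkedCrossPower k ω x y]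
    exact N.lintegral_linkedCrossPower_ne_top k ω y
  calc (N.powers ω).iCross
    _ = ∑' y : N.eve ω, ∑' x : N.bs ω,
          (N.linkedCrossPower .los ω x y + N.linkedCrossPower .ref ω x y).toReal := by
        simp only [toReal_linkedCrossPower_add]
        rfl
    _ = ∑' y : N.eve ω, (∑' x : N.bs ω, N.linkedCrossPower .los ω x y +
          ∑' x : N.bs ω, N.linkedCrossPower .ref ω x y).toReal := by
        refine tsum_congr fun y => ?_
        rw [← ENNReal.tsum_add, ENNReal.tsum_toReal_eq fun x : N.bs ω => ENNReal.add_ne_top.2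
          ⟨N.linkedCrossPower_ne_top .los ω x y, N.linkedCrossPower_ne_top .ref ω x y⟩]
    _ = (N.crossSum .los ω + N.crossSum .ref ω).toReal := by
        rw [← ENNReal.tsum_toReal_eq fun y : N.eve ω =>
            ENNReal.add_ne_top.2 ⟨hne .los y, hne .ref y⟩,
          ENNReal.tsum_add, crossSum_eq_tsum, crossSum_eq_tsum]
    _ = _ := ENNReal.toReal_add (N.crossSum_ne_top _ _) (N.crossSum_ne_top _ _)

lemma powers_eq : N.powers ω =
    { sLos := (1 - p.η) * (N.signalSum .los ω).toReal
      sRef := (1 - p.η) * (N.signalSum .ref ω).toReal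
      iLos := p.η * (N.signalSum .los ω).toReal
      iRef := p.η * (N.signalSum .ref ω).toReal
      iCross := (N.crossSum .los ω).toReal + (N.crossSum .ref ω).toReal } := by
  rw [← iCross_powers]
  simp only [powers, losPower_eq, refPower_eq, tsum_const_mul_toReal_linkedPower]

/-- The mean power, given the geometry, that the eavesdroppers receive from the typical base
station, before time switching. -/
def meanPower : ℝ :=
  p.lamE * (p.planePower .los * N.linkProb .los ω + p.planePower .ref * N.linkProb .ref ω)

lemma meanPower_of_dref_eq_zero (h0 : p.dref = 0) (hL : p.αL < 2) (hN : p.αN < 2) :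
    N.meanPower ω = Real.pi * p.r ^ 2 * p.lamE * p.Pt * p.meanGain * p.b *
      p.bracket (N.PLos ω) (N.PRef ω) := by
  simp only [meanPower, Params.planePower, Params.exponent, Params.attenuation, linkProb,
    Params.bracket, p.discLoss_of_dref_eq_zero h0 hL, p.discLoss_of_dref_eq_zero h0 hN]
  ring

section ConditionalMean

variable [IsProbabilityMeasure μ] {k}

lemma meanPower_pos (h : ∀ k, 0 < p.dref ∨ p.exponent k < 2)
    (hb : ∀ᵐ ω ∂μ, p.bracket (N.PLos ω) (N.PRef ω) ≠ 0) : ∀ᵐ ω ∂μ, 0 < N.meanPower ω := by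
  filter_upwards [hb, N.linkProb_nonneg .los, N.linkProb_nonneg .ref] with ω hbω hlos href
  have hpL : 0 < p.planePower .los := Params.planePower_pos (h _) zero_lt_one
  have hL0 : 0 ≤ p.planePower .los * N.linkProb .los ω := mul_nonneg hpL.le hlos
  have hR0 : 0 ≤ p.planePower .ref * N.linkProb .ref ω := mul_nonneg (p.planePower_nonneg _) href
  refine mul_pos p.lamE_pos ((add_nonneg hL0 hR0).lt_of_ne fun hsum => hbω ?_)
  obtain ⟨hL, hR⟩ := (add_eq_zero_iff_of_nonneg hL0 hR0).1 hsum.symm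
  have hLos : N.PLos ω * (1 - N.PRef ω) = 0 := (mul_eq_zero.1 hL).resolve_left hpL.ne'
  have hRef : p.ρ * (1 - N.PLos ω) * N.PRef ω = 0 := by
    rw [mul_assoc]
    rcases p.ρ_nonneg.eq_or_lt with hρ | hρ
    · rw [← hρ, zero_mul]
    · exact mul_eq_zero_of_right _
        ((mul_eq_zero.1 hR).resolve_left (Params.planePower_pos (k := .ref) (h _) hρ).ne')
  rw [Params.bracket, hLos, hRef, zero_mul, zero_mul, add_zero]

lemma integrable_powers (h : ∀ k, 0 < p.dref ∨ p.exponent k < 2) :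
    Integrable (fun ω => (N.powers ω).sLos) μ ∧ Integrable (fun ω => (N.powers ω).sRef) μ ∧
      Integrable (fun ω => (N.powers ω).iLos) μ ∧ Integrable (fun ω => (N.powers ω).iRef) μ ∧
      Integrable (fun ω => (N.powers ω).iCross) μ := by
  have hS (k : LinkKind) (a : ℝ) := (N.integrable_and_condExp_toReal_signalSum (h k)).1.const_mul a
  have hC (k : LinkKind) := (N.integrable_and_condExp_toReal_crossSum (h k)).1
  simp only [powers_eq]
  exact ⟨hS _ _, hS _ _, hS _ _, hS _ _, (hC _).add (hC _)⟩

lemma condExp_const_mul_signalSum (h : 0 < p.dref ∨ p.exponent k < 2) (a : ℝ) :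
    μ[fun ω => a * (N.signalSum k ω).toReal|N.geometry] =ᵐ[μ]
      fun ω => a * (p.lamE * p.planePower k * N.linkProb k ω) :=
  (condExp_smul a _ _).trans ((N.integrable_and_condExp_toReal_signalSum h).2.fun_comp (a * ·))

lemma signal_meanPowers (h : ∀ k, 0 < p.dref ∨ p.exponent k < 2) :
    ∀ᵐ ω ∂μ, (N.meanPowers ω).signal = (1 - p.η) * N.meanPower ω := by
  filter_upwards [N.condExp_const_mul_signalSum (h .los) (1 - p.η),
    N.condExp_const_mul_signalSum (h .ref) (1 - p.η)] with ω hlos href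
  simp only [Powers.signal, meanPowers, powers_eq, hlos, href, meanPower]
  ring

lemma interference_meanPowers (h : ∀ k, 0 < p.dref ∨ p.exponent k < 2) :
    ∀ᵐ ω ∂μ, (N.meanPowers ω).interference =
      (Real.pi * p.r ^ 2 * p.lamB + p.η) * N.meanPower ω := by
  obtain ⟨hintL, hcrossL⟩ := N.integrable_and_condExp_toReal_crossSum (h .los)
  obtain ⟨hintR, hcrossR⟩ := N.integrable_and_condExp_toReal_crossSum (h .ref)
  filter_upwards [N.condExp_const_mul_signalSum (h .los) p.η,
    N.condExp_const_mul_signalSum (h .ref) p.η, hcrossL, hcrossR,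
    condExp_add hintL hintR N.geometry] with ω hlos href hcrossL hcrossR hadd
  have hcross := hadd.trans (congrArg₂ (· + ·) hcrossL hcrossR)
  simp only [Pi.add_def] at hcross
  simp only [Powers.interference, meanPowers, powers_eq, hlos, href, hcross, meanPower]
  ring

end ConditionalMean

end Network

end MmWave

end

theorem theorem2 {Ω E : Type*} [MeasurableSpace Ω] [MeasurableSpace E] (μ : Measure Ω)
    [IsProbabilityMeasure μ] (p : MmWave.Params) (N : MmWave.Network p E μ)
    (hαL : p.αL ≠ 2) (hαN : p.αN ≠ 2)
    (hdref : 0 < p.dref ∨ (p.αL < 2 ∧ p.αN < 2))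
    (hbracket : ∀ᵐ ω ∂μ, p.bracket (N.PLos ω) (N.PRef ω) ≠ 0) :
    -- the aggregate powers have means, and the approximate SINR has a positive denominator
    (Integrable (fun ω => (N.powers ω).sLos) μ ∧ Integrable (fun ω => (N.powers ω).sRef) μ ∧
      Integrable (fun ω => (N.powers ω).iLos) μ ∧ Integrable (fun ω => (N.powers ω).iRef) μ ∧
      Integrable (fun ω => (N.powers ω).iCross) μ) ∧
    (∀ᵐ ω ∂μ, 0 < (N.meanPowers ω).interference) ∧
    -- the approximate eavesdropping success probability
    (∀ β : ℝ, N.approxEsp β =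
      μ {ω | β < p.numer (N.PLos ω) (N.PRef ω) / p.denom (N.PLos ω) (N.PRef ω)}) ∧
    -- for the pure power law, numerator and denominator are the mean signal and the mean
    -- interference, up to one common positive factor
    (p.dref = 0 → ∀ᵐ ω ∂μ,
      (N.meanPowers ω).signal =
        Real.pi * p.r ^ 2 * p.lamE * p.Pt * p.meanGain * p.b * p.numer (N.PLos ω) (N.PRef ω) ∧
      (N.meanPowers ω).interference =
        Real.pi * p.r ^ 2 * p.lamE * p.Pt * p.meanGain * p.b * p.denom (N.PLos ω) (N.PRef ω)) := by
  have hk : ∀ k, 0 < p.dref ∨ p.exponent k < 2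
    | .los => hdref.imp_right And.left
    | .ref => hdref.imp_right And.right
  have hpos := N.meanPower_pos hk hbracket
  have hsignal := N.signal_meanPowers hk
  have hinterference := N.interference_meanPowers hk
  refine ⟨N.integrable_powers hk, ?_, fun β => measure_congr ?_, fun h0 => ?_⟩
  · have := p.η_pos
    filter_upwards [hinterference, hpos] with ω hi hω
    rw [hi]
    positivity
  · filter_upwards [hsignal, hinterference, hpos, hbracket] with ω hs hi hω hb
    refine congrArg (β < ·) ?_
    rw [MmWave.Network.approxSinr, MmWave.Powers.sinr, add_zero, hs, hi, MmWave.Params.numer,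
      MmWave.Params.denom, mul_div_mul_right _ _ hω.ne', mul_div_mul_right _ _ hb]
  · obtain ⟨hL, hN⟩ := hdref.resolve_left h0.not_gt
    filter_upwards [hsignal, hinterference] with ω hs hi
    rw [hs, hi, N.meanPower_of_dref_eq_zero ω h0 hL hN]
    exact ⟨mul_left_comm _ _ _, mul_left_comm _ _ _⟩
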